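/- **Theorem 1.** For $f\in L_2(\mathbb R)$ let $\hat f$ be its Fourier transform, normalized so that $\hat f(\omega)=\frac1{\sqrt{2\pi}}\int_{\mathbb R}f(x)e^{-i\omega x}\,dx$ for integrable $f$, and let $(f,g)=\int_{\mathbb R}f(x)\overline{g(x)}\,dx$. For an integer $m\ge1$, a *Daubechies filter* of order $m$ is a trigonometric polynomial $$H_m(\omega)=2^{-1/2}\sum_{l=0}^{2m-1}h_m(l)e^{il\omega},\qquad h_m(l)\in\mathbb R,\qquad H_m(0)=1,$$ with $$|H_m(\omega)|^2=\Bigl(\cos^2\frac\omega2\Bigr)^m\sum_{j=0}^{m-1}\binom{m-1+j}{j}\Bigl(\sin^2\frac\omega2\Bigr)^j\quad\text{for all }\omega\in\mathbb R .$$ An *orthogonal Daubechies wavelet* $\psi_m^D$ (with $m$ vanishing moments) is a function in $L_2(\mathbb R)$ such that, for some Daubechies filter $H_m$ of order $m$ and almost every $\omega$, $$\widehat{\psi_m^D}(\omega)=e^{-i\omega/2}\,\overline{H_m\bigl(\tfrac\omega2+\pi\bigr)}\;\widehat{\varphi_m^D}\bigl(\tfrac\omega2\bigr),\qquad \widehat{\varphi_m^D}(\omega)=\frac1{\sqrt{2\pi}}\prod_{l=1}^\infty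 H_m(2^{-l}\omega).$$ For an integer $k\ge0$, real $p,q\in(1,\infty)$, $p'=p/(p-1)$ and $\psi\in L_2(\mathbb R)$, set $$W^k_{2,p'}=\{f\in L_2(\mathbb R):\|(i\omega)^k\hat f(\omega)\|_{p'}\le1\},\qquad C_{k;p,q}(\psi)=\sup_{f\in W^k_{2,p'}}\frac{|(\psi,f)|}{\|\hat\psi\|_q}\in[0,\infty].$$ Fix an integer $k\ge0$ and $p,q\in(1,\infty)$, and for every $m\ge1$ let $\psi_m^D$ be an orthogonal Daubechies wavelet with $m$ vanishing moments. Then, for every $m\ge\max(1,k)$, $$C_{k;p,q}(\psi_m^D)=\frac{\|({}_k\psi_m^D)^\wedge\|_p}{\|\widehat{\psi_m^D}\|_q},\qquad\text{where } ({}_k\psi)^\wedge(\omega)=(i\omega)^{-k}\hat\psi(\omega)$$ (with the conventions of arithmetic in $[0,\infty]$, where $a/\infty=0$ for every $a$), and $$\lim_{m\to\infty}C_{k;p,q}(\psi_m^D)=\frac{(2\pi)^{1/p-1/q}}{\pi^k}\left(\frac{1-2^{1-pk}}{pk-1}\right)^{1/p}.$$ -/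

import Mathlib

open MeasureTheory Filter Topology
open scoped ENNReal ComplexConjugate FourierTransform

noncomputable section

namespace Wavelet

/-- The space `L₂(ℝ)` of complex-valued functions. -/
abbrev L2 : Type := Lp ℂ 2 (volume : Measure ℝ)

/-- The Fourier transform on `L₂(ℝ)`, in the unitary normalization that reads
`(2π)^{-1/2} ∫ f(x) e^{-iωx} dx` for integrable `f`; Mathlib's `𝓕` has the kernel
`e^{-2πixξ}`, hence the rescaling. -/
def hat (f : L2) (ω : ℝ) : ℂ :=
  ((1 / Real.sqrt (2 * Real.pi) : ℝ) : ℂ) * (𝓕 f : L2) (ω / (2 * Real.pi))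

/-- The pairing `(f, g) = ∫ f(x) conj(g(x)) dx`. -/
def pairing (f g : L2) : ℂ := ∫ x : ℝ, f x * conj (g x)

/-- The class `W^k_{2,r}` of all `f ∈ L₂(ℝ)` with `‖(iω)^k f^(ω)‖_r ≤ 1`. -/
def sobolevClass (k : ℕ) (r : ℝ) : Set L2 :=
  {f | eLpNorm (fun ω : ℝ => (Complex.I * (ω : ℂ)) ^ k * hat f ω) (ENNReal.ofReal r) volume ≤ 1}

/-- The Fourier transform `(iω)^{-k} ψ^(ω)` of the function `_kψ`. -/
def primitiveHat (k : ℕ) (ψ : L2) (ω : ℝ) : ℂ :=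
  ((Complex.I * (ω : ℂ)) ^ k)⁻¹ * hat ψ ω

/-- The sharp constant `C_{k;p,q}(ψ)`: the supremum of `|(ψ, f)| / ‖ψ^‖_q` over
`f ∈ W^k_{2,p'}`, `p' = p / (p - 1)`, as an extended nonnegative number. -/
def sharpConst (k : ℕ) (p q : ℝ) (ψ : L2) : ℝ≥0∞ :=
  ⨆ f ∈ sobolevClass k (p / (p - 1)),
    ‖pairing ψ f‖ₑ / eLpNorm (hat ψ) (ENNReal.ofReal q) volume

/-- The trigonometric polynomial `2^{-1/2} ∑_{l=0}^{2m-1} h(l) e^{ilω}`. -/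
def trigPoly (m : ℕ) (h : ℕ → ℝ) (ω : ℝ) : ℂ :=
  ((1 / Real.sqrt 2 : ℝ) : ℂ) *
    ∑ l ∈ Finset.range (2 * m), (h l : ℂ) * Complex.exp (Complex.I * ((l * ω : ℝ) : ℂ))

/-- The polynomial `P_{m-1}(x) = ∑_{j=0}^{m-1} binom(m-1+j, j) x^j`, for `m ≥ 1`. -/
def daubechiesPoly (m : ℕ) (x : ℝ) : ℝ :=
  ∑ j ∈ Finset.range m, ((m - 1 + j).choose j : ℝ) * x ^ j

/-- `h` is the coefficient sequence of a Daubechies filter of order `m`. The modulus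
condition forces the value at `0` to be `1` or `-1`; the sign is normalized so that the infinite
product defining the scaling function converges. -/
structure IsDaubechiesFilter (m : ℕ) (h : ℕ → ℝ) : Prop where
  normSq_eq : ∀ ω : ℝ, ‖trigPoly m h ω‖ ^ 2 =
    (Real.cos (ω / 2) ^ 2) ^ m * daubechiesPoly m (Real.sin (ω / 2) ^ 2)
  at_zero : trigPoly m h 0 = 1

/-- The Fourier transform `(2π)^{-1/2} ∏_{l ≥ 1} H_m(2^{-l} ω)` of the scaling function. -/
def scalingHat (m : ℕ) (h : ℕ → ℝ) (ω : ℝ) : ℂ :=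
  ((1 / Real.sqrt (2 * Real.pi) : ℝ) : ℂ) * ∏' l : ℕ, trigPoly m h (ω / 2 ^ (l + 1))

/-- The Fourier transform `e^{-iω/2} conj(H_m(ω/2 + π)) φ^(ω/2)` of the wavelet. -/
def waveletHat (m : ℕ) (h : ℕ → ℝ) (ω : ℝ) : ℂ :=
  Complex.exp (-(Complex.I * ((ω / 2 : ℝ) : ℂ))) * conj (trigPoly m h (ω / 2 + Real.pi)) *
    scalingHat m h (ω / 2)

/-- `ψ ∈ L₂(ℝ)` is an orthogonal Daubechies wavelet `ψ_m^D`: its Fourier transform is the one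
built from some Daubechies filter of order `m`. -/
def IsDaubechiesWavelet (m : ℕ) (ψ : L2) : Prop :=
  ∃ h : ℕ → ℝ, IsDaubechiesFilter m h ∧ hat ψ =ᵐ[volume] waveletHat m h

end Wavelet

end

namespace Wavelet

/-! The formula for the sharp constant is Hölder duality on the Fourier side. By Plancherel the
pairing is ∫ ψ^ conj(f^), whose integrand has modulus |ω^{-k} ψ^| |ω^k f^|, so Hölder bounds the
supremum. The equality case, truncated to sets where everything is bounded, recovers the full norm
by monotone convergence, even if it is infinite (`iSup_pairing_eq`).

For the limit only |ψ^| matters, hence only |H_m|², a function F_m of x = sin²(ω/2). The identity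
F_m(x) + F_m(1-x) = 1 and the bound F_m(x) ≤ (4x(1-x))^(m-1) for x ≥ 1/2 force F_m to 1 for x < 1/2
and to 0 for x > 1/2: the filter becomes an ideal low-pass. So |ψ_m^| tends almost everywhere to
(2π)^(-1/2) on π < |ω| < 2π and to 0 elsewhere (`tendsto_norm_waveletHat`).

Dominated convergence needs a majorant independent of m (`IsDaubechiesFilter.norm_waveletHat_le`).
At infinity, grouping consecutive factors of the infinite product in pairs gains a geometric factor;
near 0, the zero of H_m at π absorbs ω^{-k}. The limits for (k, p) and (0, q) then give the
quotient. -/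

/-! ### The Bezout identity and bounds for the filter modulus -/

lemma daubechiesPoly_succ (n : ℕ) (x : ℝ) :
    (1 - x) * daubechiesPoly (n + 2) x = daubechiesPoly (n + 1) x +
      ((2 * n + 1).choose n : ℝ) * x ^ (n + 1) * (1 - 2 * x) := by
  -- The sums truncate the series of (1-x)^(-(n+2)) and (1-x)^(-(n+1)); by Pascal's rule,
  -- multiplying by 1-x leaves only a boundary term.
  have key : ∀ N : ℕ, (1 - x) * ∑ j ∈ Finset.range (N + 1), ((n + 1 + j).choose j : ℝ) * x ^ j =
      ∑ j ∈ Finset.range (N + 1), ((n + j).choose j : ℝ) * x ^ j -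
        ((n + 1 + N).choose N : ℝ) * x ^ (N + 1) := by
    intro N
    induction N with
    | zero => simp
    | succ N ih =>
      rw [Finset.sum_range_succ, mul_add, ih, Finset.sum_range_succ _ (N + 1)]
      have h : ((n + 1 + (N + 1)).choose (N + 1) : ℝ) =
          ((n + 1 + N).choose N : ℝ) + ((n + (N + 1)).choose (N + 1) : ℝ) := by
        rw [show n + 1 + (N + 1) = (n + 1 + N) + 1 by ring, Nat.choose_succ_succ]
        push_cast
        rw [show n + (N + 1) = n + 1 + N by ring]
      rw [h]
      ring
  have h1 := key (n + 1)
  unfold daubechiesPoly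
  simp only [show n + 2 - 1 = n + 1 by lia, show n + 1 - 1 = n by lia]
  rw [h1, Finset.sum_range_succ _ (n + 1)]
  have h2 : (n + 1 + (n + 1)).choose (n + 1) = 2 * (2 * n + 1).choose n := by
    rw [show n + 1 + (n + 1) = (2 * n + 1) + 1 by ring, Nat.choose_succ_succ,
      Nat.choose_symm_half]
    ring
  have h3 : (n + (n + 1)).choose (n + 1) = (2 * n + 1).choose n := by
    rw [show n + (n + 1) = 2 * n + 1 by ring, Nat.choose_symm_half]
  rw [h2, h3]
  push_cast
  ring

/-- Using the recurrence at x and at 1-x, the boundary terms are C x^(n+1) (1-x)^(n+1) (1-2x) and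
its negative, so the left side does not depend on n. -/
lemma bezout_daubechiesPoly (n : ℕ) (x : ℝ) :
    (1 - x) ^ (n + 1) * daubechiesPoly (n + 1) x + x ^ (n + 1) * daubechiesPoly (n + 1) (1 - x) =
      1 := by
  induction n with
  | zero => simp [daubechiesPoly]
  | succ n ih =>
    have h1 := daubechiesPoly_succ n x
    have h2 := daubechiesPoly_succ n (1 - x)
    rw [show 1 - (1 - x) = x by ring] at h2
    rw [show n + 1 + 1 = n + 2 by ring]
    linear_combination ih + (1 - x) ^ (n + 1) * h1 + x ^ (n + 1) * h2

lemma daubechiesPoly_nonneg (m : ℕ) {x : ℝ} (hx : 0 ≤ x) : 0 ≤ daubechiesPoly m x :=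
  Finset.sum_nonneg fun _ _ => by positivity

lemma daubechiesPoly_mono (m : ℕ) {x y : ℝ} (hx : 0 ≤ x) (hxy : x ≤ y) :
    daubechiesPoly m x ≤ daubechiesPoly m y := by
  unfold daubechiesPoly
  gcongr

lemma daubechiesPoly_half (n : ℕ) : daubechiesPoly (n + 1) (1 / 2) = 2 ^ n := by
  have h := bezout_daubechiesPoly n (1 / 2)
  rw [show (1 : ℝ) - 1 / 2 = 1 / 2 by norm_num] at h
  have h3 : (1 / 2 : ℝ) ^ n * 2 ^ n = 1 := by rw [← mul_pow]; norm_num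
  have h2 : (1 / 2 : ℝ) ^ n * daubechiesPoly (n + 1) (1 / 2) = (1 / 2) ^ n * 2 ^ n := by
    linear_combination h - h3
  exact mul_left_cancel₀ (by positivity) h2

/-- The polynomial has degree n and nonnegative coefficients, so passing from 1/2 to x multiplies it
by at most (2x)^n. -/
lemma daubechiesPoly_le_of_half_le (n : ℕ) {x : ℝ} (hx : 1 / 2 ≤ x) :
    daubechiesPoly (n + 1) x ≤ (4 * x) ^ n := by
  have h : daubechiesPoly (n + 1) x ≤ (2 * x) ^ n * daubechiesPoly (n + 1) (1 / 2) := by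
    unfold daubechiesPoly
    rw [Finset.mul_sum]
    refine Finset.sum_le_sum fun j hj => ?_
    have hj' : j ≤ n := by simpa [Nat.lt_succ_iff] using hj
    have h1 : x ^ j = (2 * x) ^ j * (1 / 2) ^ j := by rw [← mul_pow]; ring
    have h2 : (2 * x) ^ j ≤ (2 * x) ^ n := pow_le_pow_right₀ (by linarith) hj'
    rw [h1]
    calc _ = (2 * x) ^ j * (((n + 1 - 1 + j).choose j : ℝ) * (1 / 2) ^ j) := by ring
      _ ≤ _ := by gcongr
  refine h.trans_eq ?_
  rw [daubechiesPoly_half, ← mul_pow]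
  ring

lemma daubechiesPoly_le (n : ℕ) {x : ℝ} (hx : 0 ≤ x) :
    daubechiesPoly (n + 1) x ≤ max 2 (4 * x) ^ n := by
  rcases le_total x (1 / 2) with h | h
  · refine (daubechiesPoly_mono _ hx h).trans ?_
    rw [daubechiesPoly_half]
    gcongr
    exact le_max_left _ _
  · refine (daubechiesPoly_le_of_half_le n h).trans ?_
    gcongr
    exact le_max_right _ _

/-- The squared modulus of a Daubechies filter as a function of `x = sin² (ω / 2)`. -/
def filterSq (m : ℕ) (x : ℝ) : ℝ := (1 - x) ^ m * daubechiesPoly m x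

/-- This is |H(ω)|² + |H(ω+π)|² = 1, since shifting ω by π turns x into 1-x. -/
lemma filterSq_add (n : ℕ) (x : ℝ) : filterSq (n + 1) x + filterSq (n + 1) (1 - x) = 1 := by
  have := bezout_daubechiesPoly n x
  rwa [filterSq, filterSq, show 1 - (1 - x) = x by ring]

lemma filterSq_nonneg (m : ℕ) {x : ℝ} (hx : 0 ≤ x) (hx1 : x ≤ 1) : 0 ≤ filterSq m x :=
  mul_nonneg (pow_nonneg (by linarith) _) (daubechiesPoly_nonneg m hx)

lemma filterSq_le_one (n : ℕ) {x : ℝ} (hx : 0 ≤ x) (hx1 : x ≤ 1) : filterSq (n + 1) x ≤ 1 := by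
  have h := filterSq_nonneg (n + 1) (x := 1 - x) (by linarith) (by linarith)
  linarith [filterSq_add n x]

lemma filterSq_le_of_half_le (n : ℕ) {x : ℝ} (hx : 1 / 2 ≤ x) (hx1 : x ≤ 1) :
    filterSq (n + 1) x ≤ (4 * x * (1 - x)) ^ n := by
  have h := daubechiesPoly_le_of_half_le n hx
  have h0 := daubechiesPoly_nonneg (n + 1) (x := x) (by linarith)
  have h1 : (1 - x) ^ (n + 1) ≤ (1 - x) ^ n :=
    pow_le_pow_of_le_one (by linarith) (by linarith) (by lia)
  calc filterSq (n + 1) x ≤ (1 - x) ^ n * (4 * x) ^ n :=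
        mul_le_mul h1 h h0 (pow_nonneg (by linarith) _)
    _ = _ := by rw [← mul_pow]; ring

lemma filterSq_le_max_pow (n : ℕ) {x : ℝ} (hx : 0 ≤ x) (hx1 : x ≤ 1) :
    filterSq (n + 1) x ≤ ((1 - x) * max 2 (4 * x)) ^ (n + 1) := by
  rw [mul_pow]
  refine mul_le_mul_of_nonneg_left ?_ (pow_nonneg (by linarith) _)
  refine (daubechiesPoly_le n hx).trans (pow_le_pow_right₀ ?_ (by lia))
  exact le_max_of_le_left (by norm_num)

/-! ### Products along the doubling orbit -/

/-- Two consecutive factors contribute at most `49 / 4` instead of the naive `16`. -/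
lemma max_mul_max_le {y : ℝ} (h0 : 0 ≤ y) (h1 : y ≤ 1) :
    max 2 (4 * y) * max 2 (4 * (4 * y * (1 - y))) ≤ 49 / 4 := by
  rcases le_total y (3 / 4) with h | h
  · have ha : max 2 (4 * y) ≤ 3 := max_le (by norm_num) (by linarith)
    have hb : max 2 (4 * (4 * y * (1 - y))) ≤ 4 :=
      max_le (by norm_num) (by nlinarith [sq_nonneg (2 * y - 1)])
    nlinarith [le_max_left (2 : ℝ) (4 * y)]
  · have ha : max 2 (4 * y) ≤ 4 := max_le (by norm_num) (by linarith)
    have hb : max 2 (4 * (4 * y * (1 - y))) ≤ 3 := max_le (by norm_num) (by nlinarith)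
    nlinarith [le_max_left (2 : ℝ) (4 * y), le_max_left (2 : ℝ) (4 * (4 * y * (1 - y)))]

lemma sin_two_mul_sq (t : ℝ) :
    Real.sin (2 * t) ^ 2 = 4 * Real.sin t ^ 2 * (1 - Real.sin t ^ 2) := by
  rw [Real.sin_two_mul, mul_pow, mul_pow, Real.cos_sq']
  ring

/-- Induction by pairs, each costing 49/4 = (7/2)²; the constant 4 leaves room for an unpaired
factor. -/
lemma prod_max_le (j : ℕ) (t : ℝ) :
    ∏ i ∈ Finset.range j, max 2 (4 * Real.sin (2 ^ i * t) ^ 2) ≤ 4 * (7 / 2) ^ j := by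
  induction j using Nat.twoStepInduction generalizing t with
  | zero => simp
  | one =>
    have := Real.sin_sq_le_one t
    simp only [Finset.range_one, Finset.prod_singleton, pow_zero, one_mul, pow_one]
    exact max_le (by norm_num) (by linarith)
  | more j ih _ =>
    rw [Finset.prod_range_succ', Finset.prod_range_succ']
    have h := ih (2 ^ 2 * t)
    have h2 : ∀ i : ℕ, (2 : ℝ) ^ i * (2 ^ 2 * t) = 2 ^ (i + 1 + 1) * t := fun i => by ring
    simp only [h2] at h
    have h3 := max_mul_max_le (sq_nonneg (Real.sin t)) (Real.sin_sq_le_one t)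
    rw [← sin_two_mul_sq] at h3
    simp only [zero_add, pow_one, pow_zero, one_mul]
    rw [mul_assoc, mul_comm (max 2 (4 * Real.sin (2 * t) ^ 2))]
    calc _ ≤ 4 * (7 / 2) ^ j * (49 / 4) := mul_le_mul h h3 (by positivity) (by positivity)
      _ = _ := by ring

lemma four_pow_mul_prod_cos_sq (j : ℕ) (t : ℝ) :
    4 ^ j * Real.sin t ^ 2 * ∏ i ∈ Finset.range j, (1 - Real.sin (2 ^ i * t) ^ 2) =
      Real.sin (2 ^ j * t) ^ 2 := by
  induction j with
  | zero => simp
  | succ j ih =>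
    rw [Finset.prod_range_succ, show (2 : ℝ) ^ (j + 1) * t = 2 * (2 ^ j * t) by ring,
      sin_two_mul_sq, ← ih]
    ring

/-- The cosines telescope to at most 2·4^(-j) because sin² t ≥ 1/2, and the polynomial parts cost
4·(7/2)^j. There is decay exactly because 7/2 < 4. -/
lemma prod_filterSq_le (n j : ℕ) {t : ℝ} (ht : 1 / 2 ≤ Real.sin t ^ 2) :
    ∏ i ∈ Finset.range j, filterSq (n + 1) (Real.sin (2 ^ i * t) ^ 2) ≤
      (8 * (7 / 8) ^ j) ^ (n + 1) := by
  have h1 : ∏ i ∈ Finset.range j, (1 - Real.sin (2 ^ i * t) ^ 2) ≤ 2 * (1 / 4) ^ j := by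
    have h := four_pow_mul_prod_cos_sq j t
    have h' := Real.sin_sq_le_one (2 ^ j * t)
    have h0 : 0 ≤ ∏ i ∈ Finset.range j, (1 - Real.sin (2 ^ i * t) ^ 2) :=
      Finset.prod_nonneg fun i _ => by linarith [Real.sin_sq_le_one (2 ^ i * t)]
    rw [← h] at h'
    have h4 : (1 / 4 : ℝ) ^ j * 4 ^ j = 1 := by rw [← mul_pow]; norm_num
    set P := ∏ i ∈ Finset.range j, (1 - Real.sin (2 ^ i * t) ^ 2)
    have h5 : 4 ^ j * (1 / 2) * P ≤ 1 := le_trans (by gcongr) h'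
    calc P = 2 * ((1 / 4) ^ j * (4 ^ j * (1 / 2) * P)) := by
          linear_combination (-P) * h4
      _ ≤ 2 * ((1 / 4) ^ j * 1) := by gcongr
      _ = _ := by ring
  calc _ ≤ ∏ i ∈ Finset.range j, ((1 - Real.sin (2 ^ i * t) ^ 2) *
        max 2 (4 * Real.sin (2 ^ i * t) ^ 2)) ^ (n + 1) :=
        Finset.prod_le_prod (fun i _ => filterSq_nonneg _ (sq_nonneg _) (Real.sin_sq_le_one _))
          fun i _ => filterSq_le_max_pow n (sq_nonneg _) (Real.sin_sq_le_one _)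
    _ = ((∏ i ∈ Finset.range j, (1 - Real.sin (2 ^ i * t) ^ 2)) *
        ∏ i ∈ Finset.range j, max 2 (4 * Real.sin (2 ^ i * t) ^ 2)) ^ (n + 1) := by
        rw [Finset.prod_pow, Finset.prod_mul_distrib]
    _ ≤ (2 * (1 / 4) ^ j * (4 * (7 / 2) ^ j)) ^ (n + 1) := by
        have h0 : 0 ≤ ∏ i ∈ Finset.range j, (1 - Real.sin (2 ^ i * t) ^ 2) :=
          Finset.prod_nonneg fun i _ => by linarith [Real.sin_sq_le_one (2 ^ i * t)]
        have h2 : 0 ≤ ∏ i ∈ Finset.range j, max 2 (4 * Real.sin (2 ^ i * t) ^ 2) :=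
          Finset.prod_nonneg fun i _ => by positivity
        gcongr
        exact prod_max_le j t
    _ = _ := by
        congr 1
        rw [show (7 / 8 : ℝ) = 1 / 4 * (7 / 2) by norm_num, mul_pow]
        ring

lemma one_sub_sum_le_prod_one_sub (a : ℕ → ℝ) (h0 : ∀ i, 0 ≤ a i) (h1 : ∀ i, a i ≤ 1) (N : ℕ) :
    1 - ∑ i ∈ Finset.range N, a i ≤ ∏ i ∈ Finset.range N, (1 - a i) := by
  have hle : ∀ N, ∏ i ∈ Finset.range N, (1 - a i) ≤ 1 := fun N =>
    Finset.prod_le_one (fun i _ => by linarith [h1 i]) fun i _ => by linarith [h0 i]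
  induction N with
  | zero => simp
  | succ N ih =>
    rw [Finset.sum_range_succ, Finset.prod_range_succ]
    nlinarith [hle N, h0 N]

/-! ### The infinite product and its uniform decay -/

lemma IsDaubechiesFilter.norm_sq {m : ℕ} {h : ℕ → ℝ} (hh : IsDaubechiesFilter m h) (ω : ℝ) :
    ‖trigPoly m h ω‖ ^ 2 = filterSq m (Real.sin (ω / 2) ^ 2) := by
  rw [hh.normSq_eq, Real.cos_sq', filterSq]

lemma IsDaubechiesFilter.norm_add_pi_sq {m : ℕ} {h : ℕ → ℝ} (hh : IsDaubechiesFilter m h)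
    (ω : ℝ) : ‖trigPoly m h (ω + Real.pi)‖ ^ 2 = filterSq m (1 - Real.sin (ω / 2) ^ 2) := by
  rw [hh.norm_sq, add_div, Real.sin_add_pi_div_two, Real.cos_sq']

lemma IsDaubechiesFilter.norm_le_one {n : ℕ} {h : ℕ → ℝ} (hh : IsDaubechiesFilter (n + 1) h)
    (ω : ℝ) : ‖trigPoly (n + 1) h ω‖ ≤ 1 := by
  rw [← sq_le_one_iff₀ (norm_nonneg _), hh.norm_sq]
  exact filterSq_le_one n (sq_nonneg _) (Real.sin_sq_le_one _)

/-- A Lipschitz bound at 0: it makes the factors of the infinite product 1 + O(2^(-l)). -/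
lemma norm_trigPoly_sub_le (m : ℕ) (h : ℕ → ℝ) (ω : ℝ) :
    ‖trigPoly m h ω - trigPoly m h 0‖ ≤
      (1 / Real.sqrt 2 * ∑ l ∈ Finset.range (2 * m), |h l| * l) * |ω| := by
  unfold trigPoly
  rw [← mul_sub, ← Finset.sum_sub_distrib, norm_mul, Complex.norm_real, Real.norm_of_nonneg
    (by positivity), mul_assoc, Finset.sum_mul]
  gcongr
  refine norm_sum_le_of_le _ fun l _ => ?_
  have h1 := Real.norm_exp_I_mul_ofReal_sub_one_le (x := (l * ω : ℝ))
  rw [← mul_sub, norm_mul, Complex.norm_real, Real.norm_eq_abs, mul_zero, Complex.ofReal_zero,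
    mul_zero, Complex.exp_zero, mul_assoc]
  gcongr
  refine h1.trans_eq ?_
  rw [Real.norm_eq_abs, abs_mul, Nat.abs_cast]

/-- The infinite product `∏_{l ≥ 1} H(2^{-l} ω)`. -/
noncomputable def scalingProd (m : ℕ) (h : ℕ → ℝ) (ω : ℝ) : ℂ := ∏' l : ℕ, trigPoly m h (ω / 2 ^ (l + 1))

lemma IsDaubechiesFilter.multipliable {m : ℕ} {h : ℕ → ℝ} (hh : IsDaubechiesFilter m h) (ω : ℝ) :
    Multipliable fun l : ℕ => trigPoly m h (ω / 2 ^ (l + 1)) := by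
  set C := 1 / Real.sqrt 2 * ∑ l ∈ Finset.range (2 * m), |h l| * l
  have hs : Summable fun l : ℕ => ‖trigPoly m h (ω / 2 ^ (l + 1)) - 1‖ := by
    refine Summable.of_nonneg_of_le (fun _ => norm_nonneg _) (fun l => ?_)
      ((summable_geometric_two.mul_left (C * |ω| / 2)))
    have h1 := norm_trigPoly_sub_le m h (ω / 2 ^ (l + 1))
    rw [hh.at_zero] at h1
    refine h1.trans_eq ?_
    rw [abs_div, abs_of_pos (by positivity : (0 : ℝ) < 2 ^ (l + 1)), div_pow, one_pow, pow_succ]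
    ring
  simpa using multipliable_one_add_of_summable hs

lemma IsDaubechiesFilter.tendsto_prod {m : ℕ} {h : ℕ → ℝ} (hh : IsDaubechiesFilter m h) (ω : ℝ) :
    Tendsto (fun N => ∏ i ∈ Finset.range N, filterSq m (Real.sin (ω / 2 ^ (i + 2)) ^ 2)) atTop
      (𝓝 (‖scalingProd m h ω‖ ^ 2)) := by
  have h1 := ((hh.multipliable ω).hasProd.tendsto_prod_nat.norm.pow 2)
  refine h1.congr fun N => ?_
  rw [norm_prod, ← Finset.prod_pow]
  refine Finset.prod_congr rfl fun i _ => ?_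
  rw [hh.norm_sq, div_div, ← pow_succ]

lemma IsDaubechiesFilter.norm_scalingProd_sq_le {n : ℕ} {h : ℕ → ℝ}
    (hh : IsDaubechiesFilter (n + 1) h) (ω : ℝ) (N : ℕ) :
    ‖scalingProd (n + 1) h ω‖ ^ 2 ≤
      ∏ i ∈ Finset.range N, filterSq (n + 1) (Real.sin (ω / 2 ^ (i + 2)) ^ 2) := by
  have h0 : ∀ i, 0 ≤ filterSq (n + 1) (Real.sin (ω / 2 ^ (i + 2)) ^ 2) := fun i =>
    filterSq_nonneg _ (sq_nonneg _) (Real.sin_sq_le_one _)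
  refine Antitone.le_of_tendsto (antitone_nat_of_succ_le fun N => ?_) (hh.tendsto_prod ω) N
  rw [Finset.prod_range_succ]
  exact mul_le_of_le_one_right (Finset.prod_nonneg fun i _ => h0 i)
    (filterSq_le_one n (sq_nonneg _) (Real.sin_sq_le_one _))

lemma IsDaubechiesFilter.norm_scalingProd_le_one {n : ℕ} {h : ℕ → ℝ}
    (hh : IsDaubechiesFilter (n + 1) h) (ω : ℝ) : ‖scalingProd (n + 1) h ω‖ ≤ 1 := by
  rw [← sq_le_one_iff₀ (norm_nonneg _)]
  simpa using hh.norm_scalingProd_sq_le ω 0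

lemma IsDaubechiesFilter.norm_scalingProd_sq_le_pow {n : ℕ} {h : ℕ → ℝ}
    (hh : IsDaubechiesFilter (n + 1) h) {ω : ℝ} {j : ℕ} (h1 : 2 ^ j ≤ |ω| / (Real.pi / 2))
    (h2 : |ω| / (Real.pi / 2) < 2 ^ (j + 1)) :
    ‖scalingProd (n + 1) h ω‖ ^ 2 ≤ (8 * (7 / 8) ^ j) ^ (n + 1) := by
  have hpi := Real.pi_pos
  rw [le_div_iff₀ (by positivity)] at h1
  rw [div_lt_iff₀ (by positivity)] at h2
  -- Here π/4 ≤ |t| < π/2, and the first j arguments ω/2^(i+2) are t, 2t, ..., 2^(j-1) t in reverse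
  -- order.
  set t := ω / 2 ^ (j + 1) with ht
  have hsin : 1 / 2 ≤ Real.sin t ^ 2 := by
    rw [Real.sin_sq_eq_half_sub]
    have habs : |2 * t| = |ω| / 2 ^ j := by
      rw [ht, abs_mul, abs_div, abs_of_pos (by positivity : (0 : ℝ) < 2 ^ (j + 1)), abs_two,
        pow_succ]
      field_simp
    have hc : Real.cos (2 * t) ≤ 0 := by
      rw [← Real.cos_abs, habs]
      refine Real.cos_nonpos_of_pi_div_two_le_of_le ?_ ?_
      · rw [le_div_iff₀ (by positivity)]; linarith
      · rw [div_le_iff₀ (by positivity)]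
        rw [pow_succ] at h2
        have : (0 : ℝ) < 2 ^ j := by positivity
        nlinarith
    linarith
  refine (hh.norm_scalingProd_sq_le ω j).trans (le_trans (le_of_eq ?_) (prod_filterSq_le n j hsin))
  rw [← Finset.prod_range_reflect]
  refine Finset.prod_congr rfl fun i hi => ?_
  have hi' : i < j := Finset.mem_range.1 hi
  have : ω / 2 ^ (j - 1 - i + 2) = 2 ^ i * t := by
    rw [ht, mul_div_assoc', div_eq_div_iff (by positivity) (by positivity), mul_right_comm, ← pow_add,
      show i + (j - 1 - i + 2) = j + 1 by lia]
    ring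
  rw [this]

/-- Quadratic decay, uniform in the order of the filter. -/
lemma IsDaubechiesFilter.norm_scalingProd_le {n : ℕ} {h : ℕ → ℝ}
    (hh : IsDaubechiesFilter (n + 1) h) (hn : 20 ≤ n) (ω : ℝ) :
    ‖scalingProd (n + 1) h ω‖ ≤ 2 ^ 37 * (1 + ω ^ 2)⁻¹ := by
  have hpi := Real.pi_pos
  have hpi4 := Real.pi_le_four
  have hle := hh.norm_scalingProd_le_one ω
  rw [← div_eq_mul_inv, le_div_iff₀ (by positivity)]
  set A := ‖scalingProd (n + 1) h ω‖ with hA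
  have hA0 : 0 ≤ A := norm_nonneg _
  suffices A * ω ^ 2 ≤ 2 ^ 36 by nlinarith
  rcases lt_or_ge (|ω| / (Real.pi / 2)) 1 with hω | hω
  · rw [div_lt_one (by positivity)] at hω
    have : ω ^ 2 ≤ 2 ^ 2 := sq_le_sq' (by linarith [neg_abs_le ω]) (by linarith [le_abs_self ω])
    nlinarith [sq_nonneg ω]
  obtain ⟨j, hj1, hj2⟩ := exists_nat_pow_near hω (one_lt_two : (1 : ℝ) < 2)
  have hb := hh.norm_scalingProd_sq_le_pow hj1 hj2
  rw [div_lt_iff₀ (by positivity)] at hj2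
  set r : ℝ := 8 * (7 / 8) ^ j with hr
  have hr0 : 0 ≤ r := by positivity
  -- 21 is the least exponent e with (7/8)^e ≤ 1/16, which is what cancels ω^4 = O(16^j); hence n ≥
  -- 20. Where r ≥ 1, the trivial bound A ≤ 1 suffices.
  have hA21 : A ^ 2 ≤ r ^ 21 := by
    rcases le_total r 1 with h1 | h1
    · exact hb.trans (pow_le_pow_of_le_one hr0 h1 (by lia))
    · exact le_trans (pow_le_one₀ hA0 hle) (one_le_pow₀ h1)
  have hr21 : r ^ 21 ≤ 8 ^ 21 * (1 / 16) ^ j := by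
    rw [hr, mul_pow, ← pow_mul, mul_comm j, pow_mul]
    gcongr
    norm_num
  have hω4 : ω ^ 4 ≤ 4 ^ 4 * 16 ^ j := by
    have : |ω| ≤ 4 * 2 ^ j := by
      rw [pow_succ] at hj2
      have : (0 : ℝ) < 2 ^ j := by positivity
      nlinarith
    calc ω ^ 4 = |ω| ^ 4 := by rw [Even.pow_abs (by decide)]
      _ ≤ (4 * 2 ^ j) ^ 4 := by gcongr
      _ = _ := by
        rw [mul_pow, ← pow_mul, mul_comm j, pow_mul]
        norm_num
  have h16 : (1 / 16 : ℝ) ^ j * 16 ^ j = 1 := by rw [← mul_pow]; norm_num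
  refine le_of_sq_le_sq ?_ (by norm_num)
  calc (A * ω ^ 2) ^ 2 = A ^ 2 * ω ^ 4 := by ring
    _ ≤ (8 ^ 21 * (1 / 16) ^ j) * (4 ^ 4 * 16 ^ j) := by
      gcongr
      exact hA21.trans hr21
    _ = 8 ^ 21 * 4 ^ 4 * ((1 / 16 : ℝ) ^ j * 16 ^ j) := by ring
    _ ≤ _ := by rw [h16]; norm_num

/-! ### The low-pass limit of the filter -/

lemma tendsto_filterSq_of_half_lt {x : ℝ} (hx : 1 / 2 < x) (hx1 : x ≤ 1) :
    Tendsto (fun n : ℕ => filterSq (n + 1) x) atTop (𝓝 0) := by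
  have hr0 : 0 ≤ 4 * x * (1 - x) := mul_nonneg (by linarith) (by linarith)
  have hr1 : 4 * x * (1 - x) < 1 := by nlinarith [mul_pos (sub_pos.2 hx) (sub_pos.2 hx)]
  exact squeeze_zero (fun n => filterSq_nonneg _ (by linarith) hx1)
    (fun n => filterSq_le_of_half_le n hx.le hx1) (tendsto_pow_atTop_nhds_zero_of_lt_one hr0 hr1)

lemma tendsto_filterSq_of_lt_half {x : ℝ} (hx : 0 ≤ x) (hx1 : x < 1 / 2) :
    Tendsto (fun n : ℕ => filterSq (n + 1) x) atTop (𝓝 1) := by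
  have h := (tendsto_filterSq_of_half_lt (x := 1 - x) (by linarith) (by linarith)).const_sub 1
  rw [sub_zero] at h
  exact h.congr fun n => by linarith [filterSq_add n x]

lemma sin_sq_le_half {t : ℝ} (ht : |t| ≤ Real.pi / 4) : Real.sin t ^ 2 ≤ 1 / 2 := by
  rw [Real.sin_sq_eq_half_sub]
  have : 0 ≤ Real.cos (2 * t) := by
    rw [abs_le] at ht
    exact Real.cos_nonneg_of_neg_pi_div_two_le_of_le (by linarith) (by linarith)
  linarith

lemma sin_sq_lt_half {t : ℝ} (ht : |t| < Real.pi / 4) : Real.sin t ^ 2 < 1 / 2 := by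
  rw [Real.sin_sq_eq_half_sub]
  have : 0 < Real.cos (2 * t) := by
    rw [abs_lt] at ht
    exact Real.cos_pos_of_mem_Ioo ⟨by linarith, by linarith⟩
  linarith

lemma half_lt_sin_sq {t : ℝ} (h1 : Real.pi / 4 < |t|) (h2 : |t| ≤ Real.pi / 2) :
    1 / 2 < Real.sin t ^ 2 := by
  rw [Real.sin_sq_eq_half_sub]
  have : Real.cos (2 * t) < 0 := by
    rw [← Real.cos_abs, abs_mul, abs_two]
    exact Real.cos_neg_of_pi_div_two_lt_of_lt (by linarith) (by linarith [Real.pi_pos])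
  linarith

lemma sin_sq_le_sin_sq {s t : ℝ} (h1 : |s| ≤ |t|) (h2 : |t| ≤ Real.pi / 2) :
    Real.sin s ^ 2 ≤ Real.sin t ^ 2 := by
  have h : Real.cos (2 * |t|) ≤ Real.cos (2 * |s|) :=
    Real.cos_le_cos_of_nonneg_of_le_pi (by positivity) (by linarith) (by linarith)
  have e : ∀ u : ℝ, Real.cos (2 * |u|) = Real.cos (2 * u) := fun u => by
    rw [← Real.cos_abs (2 * u), abs_mul, abs_two]
  rw [Real.sin_sq_eq_half_sub, Real.sin_sq_eq_half_sub, ← e s, ← e t]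
  linarith

/-- For |ω| ≤ π every factor is 1 - F(1 - x i) with x i ≤ 1/2, and F(1 - x i) ≤
sin²(ω/2^(i+1))^(n+1). One power of the sine makes the defects summable; the other n keep them small
as n grows. -/
lemma IsDaubechiesFilter.le_norm_scalingProd_sq {n : ℕ} {h : ℕ → ℝ}
    (hh : IsDaubechiesFilter (n + 2) h) {ω : ℝ} (hω : |ω| ≤ Real.pi) :
    1 - (Real.sin (ω / 2) ^ 2) ^ n * ω ^ 2 ≤ ‖scalingProd (n + 2) h ω‖ ^ 2 := by
  have hpi := Real.pi_pos
  refine ge_of_tendsto' (hh.tendsto_prod ω) fun N => ?_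
  set x : ℕ → ℝ := fun i => Real.sin (ω / 2 ^ (i + 2)) ^ 2 with hx
  have hx0 : ∀ i, 0 ≤ x i := fun i => sq_nonneg _
  have hx1 : ∀ i, x i ≤ 1 := fun i => Real.sin_sq_le_one _
  have habs : ∀ i : ℕ, |ω / 2 ^ (i + 1)| ≤ |ω / 2| := fun i => by
    rw [abs_div, abs_div, abs_two, abs_of_pos (by positivity : (0 : ℝ) < 2 ^ (i + 1))]
    refine div_le_div_of_nonneg_left (abs_nonneg _) two_pos ?_
    exact le_self_pow₀ one_le_two (by lia)
  have hω2 : |ω / 2| ≤ Real.pi / 2 := by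
    rw [abs_div, abs_two]; linarith
  have hdouble : ∀ i, 4 * (1 - x i) * (1 - (1 - x i)) = Real.sin (ω / 2 ^ (i + 1)) ^ 2 := fun i => by
    rw [show ω / 2 ^ (i + 1) = 2 * (ω / 2 ^ (i + 2)) by rw [pow_succ _ (i + 1)]; field_simp,
      sin_two_mul_sq]
    simp only [hx]
    ring
  have hterm : ∀ i, filterSq (n + 2) (1 - x i) ≤
      (Real.sin (ω / 2) ^ 2) ^ n * ω ^ 2 * (1 / 2 / 2 ^ i) := fun i => by
    have hhalf : x i ≤ 1 / 2 := by
      refine sin_sq_le_half ?_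
      have := habs i
      rw [pow_succ, ← div_div, abs_div, abs_two]
      linarith
    have hb := filterSq_le_of_half_le (n + 1) (x := 1 - x i) (by linarith) (by linarith [hx0 i])
    rw [hdouble, pow_succ] at hb
    refine hb.trans ?_
    rw [mul_assoc]
    have hs : Real.sin (ω / 2 ^ (i + 1)) ^ 2 ≤ ω ^ 2 * (1 / 2 / 2 ^ i) := by
      have h1 : Real.sin (ω / 2 ^ (i + 1)) ^ 2 ≤ (ω / 2 ^ (i + 1)) ^ 2 := sq_le_sq.2 Real.abs_sin_le_abs
      refine h1.trans ?_
      rw [div_pow, div_eq_mul_inv]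
      gcongr
      rw [div_div, ← pow_succ', one_div]
      gcongr
      exact le_self_pow₀ (one_le_pow₀ one_le_two) (by lia)
    exact mul_le_mul (pow_le_pow_left₀ (sq_nonneg _) (sin_sq_le_sin_sq (habs i) hω2) n) hs
      (sq_nonneg _) (by positivity)
  have hprod := one_sub_sum_le_prod_one_sub (fun i => filterSq (n + 2) (1 - x i))
    (fun i => filterSq_nonneg _ (by linarith [hx1 i]) (by linarith [hx0 i]))
    (fun i => filterSq_le_one (n + 1) (by linarith [hx1 i]) (by linarith [hx0 i])) N
  have e : ∀ i, 1 - filterSq (n + 2) (1 - x i) = filterSq (n + 2) (x i) := fun i => by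
    linarith [filterSq_add (n + 1) (x i)]
  simp only [e] at hprod
  refine le_trans ?_ hprod
  have hsum : ∑ i ∈ Finset.range N, filterSq (n + 2) (1 - x i) ≤
      (Real.sin (ω / 2) ^ 2) ^ n * ω ^ 2 := by
    refine (Finset.sum_le_sum fun i _ => hterm i).trans ?_
    rw [← Finset.mul_sum]
    refine mul_le_of_le_one_right (by positivity) ?_
    refine ((summable_geometric_two' 1).sum_le_tsum _ fun i _ => by positivity).trans_eq ?_
    exact tsum_geometric_two' 1
  linarith

/-! ### Plancherel and the duality formula -/

lemma measurable_hat (f : L2) : Measurable (hat f) :=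
  ((Lp.stronglyMeasurable (𝓕 f : L2)).measurable.comp (measurable_id.div_const _)).const_mul _

lemma quasiMeasurePreserving_mul_left {a : ℝ} (ha : a ≠ 0) :
    Measure.QuasiMeasurePreserving (a * ·) (volume : Measure ℝ) volume :=
  ⟨measurable_const_mul a, by
    rw [Real.map_volume_mul_left ha]
    exact Measure.smul_absolutelyContinuous⟩

/-- The squared prefactor of `hat` cancels the Jacobian 2π of the rescaling. -/
lemma pairing_eq_integral_hat (f g : L2) : pairing f g = ∫ ω, hat f ω * conj (hat g ω) := by
  have hpi := Real.pi_pos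
  have h1 : ∀ f g : L2, inner ℂ g f = ∫ x, f x * conj (g x) := fun f g => by
    rw [L2.inner_def]
    rfl
  have h2 : pairing f g = ∫ x, (𝓕 f : L2) x * conj ((𝓕 g : L2) x) := by
    rw [← h1, Lp.inner_fourier_eq, h1, pairing]
  have h3 := Measure.integral_comp_div
    (fun x => (𝓕 f : L2) x * conj ((𝓕 g : L2) x)) (2 * Real.pi)
  have hs : Real.sqrt (2 * Real.pi) ^ 2 = 2 * Real.pi := Real.sq_sqrt (by positivity)
  have h4 : ∀ ω, hat f ω * conj (hat g ω) = ((1 / (2 * Real.pi) : ℝ) : ℂ) *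
      ((𝓕 f : L2) (ω / (2 * Real.pi)) * conj ((𝓕 g : L2) (ω / (2 * Real.pi)))) := fun ω => by
    have : ((1 / (2 * Real.pi) : ℝ) : ℂ) = ((1 / Real.sqrt (2 * Real.pi) : ℝ) : ℂ) *
        ((1 / Real.sqrt (2 * Real.pi) : ℝ) : ℂ) := by
      rw [← Complex.ofReal_mul, div_mul_div_comm, ← sq (Real.sqrt _), hs, one_mul]
    rw [hat, hat, map_mul, Complex.conj_ofReal, this]
    ring
  simp_rw [h4]
  rw [integral_const_mul, h3, h2, abs_of_pos (by positivity), Complex.real_smul, ← mul_assoc,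
    ← Complex.ofReal_mul, one_div, inv_mul_cancel₀ (by positivity), Complex.ofReal_one, one_mul]

lemma exists_hat_ae_eq {F : ℝ → ℂ} (hF : MemLp F 2 volume) : ∃ f : L2, hat f =ᵐ[volume] F := by
  have hpi := Real.pi_pos
  have h2pi : (2 * Real.pi) ≠ 0 := by positivity
  set G : ℝ → ℂ := fun x => (Real.sqrt (2 * Real.pi) : ℂ) * F (2 * Real.pi * x) with hG
  have hGm : MemLp G 2 volume := by
    refine MemLp.const_mul ?_ _
    refine MemLp.comp_of_map (f := fun x => 2 * Real.pi * x) ?_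
      (measurable_const_mul _).aemeasurable
    rw [Real.map_volume_mul_left h2pi]
    exact hF.smul_measure ENNReal.ofReal_ne_top
  refine ⟨(𝓕⁻ (hGm.toLp G) : L2), ?_⟩
  have h1 : (𝓕 (𝓕⁻ (hGm.toLp G) : L2) : L2) =ᵐ[volume] G := by
    rw [FourierTransform.fourier_fourierInv_eq]
    exact hGm.coeFn_toLp
  have h2 := (quasiMeasurePreserving_mul_left (inv_ne_zero h2pi)).ae_eq_comp h1
  filter_upwards [h2] with ω hω
  simp only [Function.comp_apply] at hω
  rw [hat, div_eq_inv_mul ω, hω, hG, ← mul_assoc, ← Complex.ofReal_mul,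
    one_div_mul_cancel (by positivity), Complex.ofReal_one, one_mul, mul_inv_cancel_left₀ h2pi]

lemma norm_I_mul_pow (k : ℕ) (ω : ℝ) : ‖(Complex.I * (ω : ℂ)) ^ k‖ = |ω| ^ k := by
  rw [norm_pow, norm_mul, Complex.norm_I, one_mul, Complex.norm_real, Real.norm_eq_abs]

lemma I_mul_pow_ne_zero (k : ℕ) {ω : ℝ} (hω : ω ≠ 0) : (Complex.I * (ω : ℂ)) ^ k ≠ 0 :=
  pow_ne_zero _ (mul_ne_zero Complex.I_ne_zero (Complex.ofReal_ne_zero.2 hω))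

/-- Equality case of Hölder's inequality on a set where all functions involved are bounded. -/
lemma exists_extremal (k : ℕ) {p p' : ℝ} (hpp : p.HolderConjugate p') {u : ℝ → ℂ}
    (hu : Measurable u) {E : Set ℝ} (hE : MeasurableSet E) (hEfin : volume E ≠ ∞) {δ B : ℝ}
    (hδ : 0 < δ) (hB : 0 ≤ B) (hEδ : ∀ ω ∈ E, δ ≤ |ω|)
    (hEB : ∀ ω ∈ E, ‖((Complex.I * (ω : ℂ)) ^ k)⁻¹ * u ω‖ ≤ B) :
    ∃ F : ℝ → ℂ, MemLp F 2 volume ∧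
      eLpNorm (fun ω : ℝ => (Complex.I * (ω : ℂ)) ^ k * F ω) (ENNReal.ofReal p') volume ≤ 1 ∧
      ‖∫ ω, u ω * conj (F ω)‖ₑ =
        (∫⁻ ω in E, ‖((Complex.I * (ω : ℂ)) ^ k)⁻¹ * u ω‖ₑ ^ p) ^ (1 / p) := by
  have hp0 : 0 < p := hpp.pos
  have hp0' : 0 < p' := hpp.symm.pos
  have hp1 : 0 < p - 1 := hpp.sub_one_pos
  set g : ℝ → ℂ := fun ω => ((Complex.I * (ω : ℂ)) ^ k)⁻¹ * u ω with hg
  have hgm : Measurable g :=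
    (((Complex.measurable_ofReal.const_mul Complex.I).pow_const k).inv).mul hu
  have hgu : ∀ ω ∈ E, ‖u ω‖ = |ω| ^ k * ‖g ω‖ := fun ω hω => by
    have : 0 < |ω| := hδ.trans_le (hEδ ω hω)
    rw [hg, norm_mul, norm_inv, norm_I_mul_pow, mul_inv_cancel_left₀ (by positivity)]
  set I := ∫⁻ ω in E, ‖g ω‖ₑ ^ p with hI
  have hItop : I ≠ ∞ := by
    refine (lt_of_le_of_lt (setLIntegral_mono (g := fun _ => ENNReal.ofReal (B ^ p))
      measurable_const fun ω hω => ?_) ?_).ne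
    · rw [← ofReal_norm, ENNReal.ofReal_rpow_of_nonneg (norm_nonneg _) hp0.le]
      exact ENNReal.ofReal_le_ofReal (Real.rpow_le_rpow (norm_nonneg _) (hEB ω hω) hp0.le)
    · rw [setLIntegral_const]
      exact ENNReal.mul_lt_top ENNReal.ofReal_lt_top hEfin.lt_top
  rcases eq_or_ne I 0 with hI0 | hI0
  · refine ⟨0, MemLp.zero, by simp, ?_⟩
    rw [hI0, ENNReal.zero_rpow_of_pos (by positivity)]
    simp
  set J := I.toReal with hJ
  have hJ0 : 0 < J := ENNReal.toReal_pos hI0 hItop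
  have hIJ : I = ENNReal.ofReal J := (ENNReal.ofReal_toReal hItop).symm
  -- Since (p-1)p' = p, this c normalizes ‖g‖^(p-1) on E to unit norm in L_{p'}; `w` divides out
  -- |ω|^k, and `F` takes its phase from `u`.
  set c : ℝ := J ^ (-(1 / p')) with hc
  have hc0 : 0 < c := Real.rpow_pos_of_pos hJ0 _
  set w : ℝ → ℝ := fun ω => ‖g ω‖ ^ (p - 1) * c / |ω| ^ k with hw
  have hw0 : ∀ ω, 0 ≤ w ω := fun ω => by positivity
  have hwm : Measurable w :=
    ((hgm.norm.pow_const (p - 1)).mul_const c).div (measurable_id.abs.pow_const k)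
  set F : ℝ → ℂ := E.indicator fun ω => u ω / (‖u ω‖ : ℂ) * (w ω : ℂ) with hF
  have hnorm1 : ∀ z : ℂ, ‖z / (‖z‖ : ℂ)‖ ≤ 1 := fun z => by
    rw [norm_div, Complex.norm_real, norm_norm]
    exact div_self_le_one _
  have hFm : Measurable fun ω => u ω / (‖u ω‖ : ℂ) * (w ω : ℂ) :=
    (hu.div (Complex.measurable_ofReal.comp hu.norm)).mul (Complex.measurable_ofReal.comp hwm)
  have hFw : ∀ ω, ‖u ω / (‖u ω‖ : ℂ) * (w ω : ℂ)‖ ≤ w ω := fun ω => by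
    rw [norm_mul, Complex.norm_real, Real.norm_of_nonneg (hw0 ω)]
    exact mul_le_of_le_one_left (hw0 ω) (hnorm1 _)
  refine ⟨F, ?_, ?_, ?_⟩
  · rw [hF, memLp_indicator_iff_restrict hE]
    have : IsFiniteMeasure (volume.restrict E) := ⟨by simpa using hEfin.lt_top⟩
    refine MemLp.of_bound hFm.aestronglyMeasurable (B ^ (p - 1) * c / δ ^ k) ?_
    filter_upwards [ae_restrict_mem hE] with ω hω
    refine (hFw ω).trans ?_
    simp only [hw]
    gcongr
    · exact hEB ω hω
    · exact hEδ ω hω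
  · rw [eLpNorm_eq_lintegral_rpow_enorm_toReal (by simpa using hp0') ENNReal.ofReal_ne_top,
      ENNReal.toReal_ofReal hp0'.le]
    refine ENNReal.rpow_le_one ?_ (by positivity)
    have hle : ∀ ω : ℝ, ‖(Complex.I * (ω : ℂ)) ^ k * F ω‖ₑ ^ p' ≤
        E.indicator (fun ω => ENNReal.ofReal (J⁻¹) * ‖g ω‖ₑ ^ p) ω := fun ω => by
      by_cases hω : ω ∈ E
      · have hω0 : 0 < |ω| := hδ.trans_le (hEδ ω hω)
        rw [hF, Set.indicator_of_mem hω, Set.indicator_of_mem hω, ← ofReal_norm,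
          ← ofReal_norm, ENNReal.ofReal_rpow_of_nonneg (norm_nonneg _) hp0'.le,
          ENNReal.ofReal_rpow_of_nonneg (norm_nonneg _) hp0.le, ← ENNReal.ofReal_mul (by positivity)]
        refine ENNReal.ofReal_le_ofReal ?_
        have h1 : ‖(Complex.I * (ω : ℂ)) ^ k * (u ω / (‖u ω‖ : ℂ) * (w ω : ℂ))‖ ≤
            ‖g ω‖ ^ (p - 1) * c := by
          rw [norm_mul, norm_I_mul_pow]
          calc _ ≤ |ω| ^ k * w ω := by gcongr; exact hFw ω
            _ = _ := by rw [hw]; field_simp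
        calc _ ≤ (‖g ω‖ ^ (p - 1) * c) ^ p' := Real.rpow_le_rpow (norm_nonneg _) h1 hp0'.le
          _ = _ := by
            rw [Real.mul_rpow (by positivity) hc0.le, ← Real.rpow_mul (norm_nonneg _),
              hpp.sub_one_mul_conj, hc, ← Real.rpow_mul hJ0.le, neg_mul,
              one_div_mul_cancel hp0'.ne', Real.rpow_neg_one, mul_comm]
      · rw [hF, Set.indicator_of_notMem hω, Set.indicator_of_notMem hω, mul_zero, enorm_zero,
          ENNReal.zero_rpow_of_pos hp0']
    refine (lintegral_mono hle).trans ?_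
    rw [lintegral_indicator hE, lintegral_const_mul _ (hgm.enorm.pow_const p), ← hI, hIJ,
      ← ENNReal.ofReal_mul (by positivity), inv_mul_cancel₀ hJ0.ne', ENNReal.ofReal_one]
  · have hpt : ∀ ω, u ω * conj (F ω) = ((E.indicator (fun ω => c * ‖g ω‖ ^ p) ω : ℝ) : ℂ) :=
      fun ω => by
      by_cases hω : ω ∈ E
      · have hω0 : 0 < |ω| := hδ.trans_le (hEδ ω hω)
        rw [hF, Set.indicator_of_mem hω, Set.indicator_of_mem hω, map_mul, map_div₀,
          Complex.conj_ofReal, Complex.conj_ofReal, ← mul_assoc, ← mul_div_assoc, Complex.mul_conj,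
          Complex.normSq_eq_norm_sq, ← Complex.ofReal_div, ← Complex.ofReal_mul]
        congr 1
        rw [sq, mul_self_div_self, hgu ω hω, hw]
        have h1 : ‖g ω‖ ^ p = ‖g ω‖ * ‖g ω‖ ^ (p - 1) := by
          rcases eq_or_ne ‖g ω‖ 0 with h0 | h0
          · rw [h0, zero_mul, Real.zero_rpow hp0.ne']
          · rw [← Real.rpow_one_add' (norm_nonneg _) (by linarith)]
            congr 1
            ring
        rw [h1]
        field_simp
      · rw [hF, Set.indicator_of_notMem hω, Set.indicator_of_notMem hω]
        simp
    have hint : ∫ ω in E, ‖g ω‖ ^ p = J := by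
      rw [integral_eq_lintegral_of_nonneg_ae (Eventually.of_forall fun ω => by positivity)
        (hgm.norm.pow_const p).aestronglyMeasurable, hJ, hI]
      congr 1
      refine lintegral_congr fun ω => ?_
      rw [← ofReal_norm, ENNReal.ofReal_rpow_of_nonneg (norm_nonneg _) hp0.le]
    simp_rw [hpt]
    rw [integral_complex_ofReal, integral_indicator hE, integral_const_mul, hint,
      ← ofReal_norm, Complex.norm_real, Real.norm_of_nonneg (by positivity), hIJ,
      ENNReal.ofReal_rpow_of_pos hJ0, hc]
    congr 1
    nth_rewrite 2 [← Real.rpow_one J]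
    rw [← Real.rpow_add hJ0]
    congr 1
    have := hpp.inv_add_inv_eq_one
    rw [one_div, one_div]
    linarith

/-- The duality formula behind the sharp constant; it holds for every `ψ ∈ L₂(ℝ)`. -/
lemma iSup_pairing_eq (k : ℕ) {p : ℝ} (hp : 1 < p) (ψ : L2) :
    ⨆ f ∈ sobolevClass k (p / (p - 1)), ‖pairing ψ f‖ₑ =
      eLpNorm (primitiveHat k ψ) (ENNReal.ofReal p) volume := by
  have hpp : p.HolderConjugate (p / (p - 1)) := Real.HolderConjugate.conjExponent hp
  set p' := p / (p - 1)
  have hp0 : 0 < p := hpp.pos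
  have hp0' : 0 < p' := hpp.symm.pos
  have hu := measurable_hat ψ
  have hIm : ∀ k : ℕ, Measurable fun ω : ℝ => (Complex.I * (ω : ℂ)) ^ k := fun k =>
    (Complex.measurable_ofReal.const_mul Complex.I).pow_const k
  have hgm : Measurable (primitiveHat k ψ) := (hIm k).inv.mul hu
  rw [eLpNorm_eq_lintegral_rpow_enorm_toReal (by simpa using hp0) ENNReal.ofReal_ne_top,
    ENNReal.toReal_ofReal hp0.le]
  refine le_antisymm (iSup₂_le fun f hf => ?_) ?_
  · rw [sobolevClass, Set.mem_ofPred_eq,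
      eLpNorm_eq_lintegral_rpow_enorm_toReal (by simpa using hp0') ENNReal.ofReal_ne_top,
      ENNReal.toReal_ofReal hp0'.le] at hf
    rw [pairing_eq_integral_hat]
    refine (enorm_integral_le_lintegral_enorm _).trans ?_
    have h0 : ∀ᵐ ω : ℝ, ω ≠ 0 := by simp [ae_iff]
    have h1 : ∫⁻ ω, ‖hat ψ ω * conj (hat f ω)‖ₑ = ∫⁻ ω, ((fun ω => ‖primitiveHat k ψ ω‖ₑ) *
        fun ω : ℝ => ‖(Complex.I * (ω : ℂ)) ^ k * hat f ω‖ₑ) ω := by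
      refine lintegral_congr_ae ?_
      filter_upwards [h0] with ω hω
      have := I_mul_pow_ne_zero k hω
      rw [Pi.mul_apply, ← enorm_mul, enorm_mul (hat ψ ω), RCLike.enorm_conj, ← enorm_mul]
      congr 1
      rw [primitiveHat]
      field_simp
    rw [h1]
    refine (ENNReal.lintegral_mul_le_Lp_mul_Lq volume hpp hgm.enorm.aemeasurable
      ((hIm k).mul (measurable_hat f)).enorm.aemeasurable).trans ?_
    exact mul_le_of_le_one_right' hf
  · set S := ⨆ f ∈ sobolevClass k p', ‖pairing ψ f‖ₑ
    rw [one_div, ENNReal.rpow_inv_le_iff hp0]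
    -- Distance from 0, finite measure and boundedness put the extremal function in L₂; these sets
    -- increase to all ω ≠ 0.
    set E : ℕ → Set ℝ := fun n =>
      {ω | ((n : ℝ) + 1)⁻¹ ≤ |ω| ∧ |ω| ≤ n + 1 ∧ ‖primitiveHat k ψ ω‖ ≤ n} with hEdef
    have hEm : ∀ n, MeasurableSet (E n) := fun n =>
      (measurableSet_le measurable_const measurable_id.abs).inter
        ((measurableSet_le measurable_id.abs measurable_const).inter
          (measurableSet_le hgm.norm measurable_const))
    have hEmono : Monotone E := by
      intro a b hab ω hω
      have hab' : (a : ℝ) ≤ b := by exact_mod_cast hab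
      refine ⟨le_trans ?_ hω.1, hω.2.1.trans (by linarith), hω.2.2.trans hab'⟩
      gcongr
    have hEfin : ∀ n, volume (E n) ≠ ∞ := fun n => by
      refine (lt_of_le_of_lt (measure_mono (t := Set.Icc (-((n : ℝ) + 1)) (n + 1)) fun ω hω => ?_)
        measure_Icc_lt_top).ne
      exact abs_le.1 hω.2.1
    have hEU : ⋃ n, E n =ᵐ[volume] (Set.univ : Set ℝ) := by
      refine eventuallyEq_set.2 ?_
      have h0 : ∀ᵐ ω : ℝ, ω ≠ 0 := by simp [ae_iff]
      filter_upwards [h0] with ω hω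
      simp only [Set.mem_iUnion, Set.mem_univ, iff_true]
      obtain ⟨n, hn⟩ := exists_nat_ge (max (|ω|)⁻¹ (max |ω| ‖primitiveHat k ψ ω‖))
      have h1 := (le_max_left _ _).trans hn
      have h2 := ((le_max_left _ _).trans (le_max_right _ _)).trans hn
      have h3 := ((le_max_right _ _).trans (le_max_right _ _)).trans hn
      refine ⟨n, ?_, by linarith, h3⟩
      rw [inv_le_comm₀ (by positivity) (abs_pos.2 hω)]
      linarith
    rw [← setLIntegral_univ, ← setLIntegral_congr hEU,
      setLIntegral_iUnion_of_directed _ hEmono.directed_le]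
    refine iSup_le fun n => ?_
    obtain ⟨F, hF2, hF1, hFe⟩ := exists_extremal k hpp hu (hEm n) (hEfin n)
      (δ := ((n : ℝ) + 1)⁻¹) (B := n) (by positivity) (by positivity) (fun ω hω => hω.1)
      (fun ω hω => hω.2.2)
    obtain ⟨f, hf⟩ := exists_hat_ae_eq hF2
    have hmem : f ∈ sobolevClass k p' := by
      rw [sobolevClass, Set.mem_ofPred_eq]
      refine le_trans (le_of_eq (eLpNorm_congr_ae ?_)) hF1
      filter_upwards [hf] with ω hω
      rw [hω]
    have hpair : pairing ψ f = ∫ ω, hat ψ ω * conj (F ω) := by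
      rw [pairing_eq_integral_hat]
      refine integral_congr_ae ?_
      filter_upwards [hf] with ω hω
      rw [hω]
    rw [← ENNReal.rpow_inv_le_iff hp0, ← one_div]
    refine le_trans (le_of_eq ?_) (le_iSup₂ (f := fun f _ => ‖pairing ψ f‖ₑ) f hmem)
    rw [hpair, hFe]
    rfl

lemma sharpConst_eq (k : ℕ) {p : ℝ} (q : ℝ) (hp : 1 < p) (ψ : L2) :
    sharpConst k p q ψ = eLpNorm (primitiveHat k ψ) (ENNReal.ofReal p) volume /
      eLpNorm (hat ψ) (ENNReal.ofReal q) volume := by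
  rw [← iSup_pairing_eq k hp ψ, sharpConst]
  simp_rw [ENNReal.iSup_div]

/-! ### Majorant and pointwise limit of the wavelet transform -/

/-- The high-order zero of H at π is quantified by |H(ω/2+π)|² ≤ (sin²(ω/2))^n. -/
lemma IsDaubechiesFilter.norm_add_pi_le {n k : ℕ} {h : ℕ → ℝ}
    (hh : IsDaubechiesFilter (n + 1) h) (hk : k ≤ n) {ω : ℝ} (hω : |ω| ≤ 1) :
    ‖trigPoly (n + 1) h (ω / 2 + Real.pi)‖ ≤ |ω| ^ k := by
  rw [← sq_le_sq₀ (norm_nonneg _) (by positivity), hh.norm_add_pi_sq, ← pow_mul, mul_comm k,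
    pow_mul, sq_abs]
  set t := ω / 2 / 2 with ht
  have habs : |t| = |ω| / 4 := by rw [ht, div_div, abs_div]; norm_num
  have h1 : Real.sin t ^ 2 ≤ 1 / 2 := sin_sq_le_half (by rw [habs]; linarith [Real.pi_gt_three])
  have h2 := filterSq_le_of_half_le n (x := 1 - Real.sin t ^ 2) (by linarith)
    (by linarith [sq_nonneg (Real.sin t)])
  have h3 : 4 * (1 - Real.sin t ^ 2) * (1 - (1 - Real.sin t ^ 2)) = Real.sin (ω / 2) ^ 2 := by
    rw [show ω / 2 = 2 * t by rw [ht]; ring, sin_two_mul_sq]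
    ring
  rw [h3] at h2
  refine h2.trans ((pow_le_pow_of_le_one (sq_nonneg _) (Real.sin_sq_le_one _) hk).trans ?_)
  refine pow_le_pow_left₀ (sq_nonneg _) ?_ k
  have h4 : Real.sin (ω / 2) ^ 2 ≤ (ω / 2) ^ 2 := sq_le_sq.2 Real.abs_sin_le_abs
  nlinarith [sq_nonneg ω]

lemma tendsto_norm_scalingProd_of_lt {h : ℕ → ℕ → ℝ}
    (hh : ∀ n, IsDaubechiesFilter (n + 1) (h (n + 1))) {ω : ℝ} (hω : |ω| < Real.pi) :
    Tendsto (fun n => ‖scalingProd (n + 1) (h (n + 1)) ω‖ ^ 2) atTop (𝓝 1) := by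
  rw [← tendsto_add_atTop_iff_nat 1]
  have hcos : 0 < Real.cos (ω / 2) := by
    rw [abs_lt] at hω
    exact Real.cos_pos_of_mem_Ioo ⟨by linarith, by linarith⟩
  have hρ : Real.sin (ω / 2) ^ 2 < 1 := by
    rw [Real.sin_sq]
    linarith [pow_pos hcos 2]
  have hlow : Tendsto (fun n : ℕ => 1 - (Real.sin (ω / 2) ^ 2) ^ n * ω ^ 2) atTop (𝓝 1) := by
    simpa using ((tendsto_pow_atTop_nhds_zero_of_lt_one (sq_nonneg _) hρ).mul_const
      (ω ^ 2)).const_sub 1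
  refine tendsto_of_tendsto_of_tendsto_of_le_of_le hlow tendsto_const_nhds
    (fun n => (hh (n + 1)).le_norm_scalingProd_sq hω.le) fun n => ?_
  exact pow_le_one₀ (norm_nonneg _) ((hh (n + 1)).norm_scalingProd_le_one ω)

lemma tendsto_norm_scalingProd_of_gt {h : ℕ → ℕ → ℝ}
    (hh : ∀ n, IsDaubechiesFilter (n + 1) (h (n + 1))) {ω : ℝ} (hω : Real.pi < |ω|) :
    Tendsto (fun n => ‖scalingProd (n + 1) (h (n + 1)) ω‖ ^ 2) atTop (𝓝 0) := by
  have hpi := Real.pi_pos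
  have hex : ∃ N : ℕ, |ω| / 2 ^ N ≤ Real.pi := by
    obtain ⟨N, hN⟩ := pow_unbounded_of_one_lt (|ω| / Real.pi) (one_lt_two : (1 : ℝ) < 2)
    refine ⟨N, ?_⟩
    rw [div_lt_iff₀ hpi] at hN
    rw [div_le_iff₀ (by positivity)]
    linarith
  classical
  -- The least halving reaching [0, π] puts |ω|/2^(N+2) in (π/4, π/2], so the factor of index N
  -- alone tends to 0; the others are at most 1.
  obtain ⟨N, hN⟩ : ∃ N, Nat.find hex = N + 1 := by
    refine Nat.exists_eq_succ_of_ne_zero fun h0 => ?_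
    have := Nat.find_spec hex
    rw [h0, pow_zero, div_one] at this
    linarith
  have h1 := Nat.find_spec hex
  have h2 := Nat.find_min hex (m := N) (by lia)
  rw [hN] at h1
  have habs : |ω / 2 ^ (N + 2)| = |ω| / 2 ^ (N + 1) / 2 := by
    rw [abs_div, abs_of_pos (by positivity : (0 : ℝ) < 2 ^ (N + 2)), div_div, ← pow_succ]
  have hhalf := half_lt_sin_sq (t := ω / 2 ^ (N + 2))
    (by rw [habs, pow_succ, ← div_div]; linarith) (by rw [habs]; linarith)
  refine squeeze_zero (fun n => sq_nonneg _) (fun n => ?_)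
    (tendsto_filterSq_of_half_lt hhalf (Real.sin_sq_le_one _))
  refine ((hh n).norm_scalingProd_sq_le ω (N + 1)).trans ?_
  rw [Finset.prod_range_succ]
  refine mul_le_of_le_one_left (filterSq_nonneg _ (sq_nonneg _) (Real.sin_sq_le_one _)) ?_
  exact Finset.prod_le_one (fun i _ => filterSq_nonneg _ (sq_nonneg _) (Real.sin_sq_le_one _))
    fun i _ => filterSq_le_one n (sq_nonneg _) (Real.sin_sq_le_one _)

lemma norm_waveletHat (m : ℕ) (h : ℕ → ℝ) (ω : ℝ) :
    ‖waveletHat m h ω‖ = 1 / Real.sqrt (2 * Real.pi) *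
      (‖trigPoly m h (ω / 2 + Real.pi)‖ * ‖scalingProd m h (ω / 2)‖) := by
  have h1 : ‖Complex.exp (-(Complex.I * ((ω / 2 : ℝ) : ℂ)))‖ = 1 := by
    rw [← mul_neg, ← Complex.ofReal_neg, mul_comm, Complex.norm_exp_ofReal_mul_I]
  rw [waveletHat, scalingHat, norm_mul, norm_mul, h1, one_mul, RCLike.norm_conj, norm_mul,
    Complex.norm_real, Real.norm_of_nonneg (by positivity), scalingProd]
  ring

/-- For |ω| ≤ 1 the zero at π supplies |ω|^k; for |ω| ≥ 1 that power is at least 1 and the quadratic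
decay suffices. -/
lemma IsDaubechiesFilter.norm_waveletHat_le {n k : ℕ} {h : ℕ → ℝ}
    (hh : IsDaubechiesFilter (n + 1) h) (hn : 20 ≤ n) (hk : k ≤ n) (ω : ℝ) :
    ‖waveletHat (n + 1) h ω‖ ≤ |ω| ^ k * (2 ^ 40 * (1 + ω ^ 2)⁻¹) := by
  have hc : 1 / Real.sqrt (2 * Real.pi) ≤ 1 := by
    rw [div_le_one (by positivity), Real.one_le_sqrt]
    linarith [Real.pi_gt_three]
  have hS := hh.norm_scalingProd_le hn (ω / 2)
  have hH := hh.norm_le_one (ω / 2 + Real.pi)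
  have hS1 := hh.norm_scalingProd_le_one (ω / 2)
  rw [norm_waveletHat]
  refine (mul_le_of_le_one_left (by positivity) hc).trans ?_
  rcases le_total |ω| 1 with hω | hω
  · have h1 : ω ^ 2 ≤ 1 := by rw [← sq_abs]; exact pow_le_one₀ (abs_nonneg _) hω
    have h2 : 1 ≤ 2 ^ 40 * (1 + ω ^ 2)⁻¹ := by
      rw [← div_eq_mul_inv, le_div_iff₀ (by positivity)]
      linarith
    gcongr
    · exact hh.norm_add_pi_le hk hω
    · exact hS1.trans h2
  · refine mul_le_mul (hH.trans (one_le_pow₀ hω)) (hS.trans ?_) (norm_nonneg _) (by positivity)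
    rw [← div_eq_mul_inv, ← div_eq_mul_inv, div_le_div_iff₀ (by positivity) (by positivity)]
    nlinarith [sq_nonneg ω]

/-- The frequency band to which the Daubechies wavelets concentrate. -/
def band : Set ℝ := {ω | Real.pi < |ω| ∧ |ω| < 2 * Real.pi}

lemma tendsto_norm_waveletHat {h : ℕ → ℕ → ℝ}
    (hh : ∀ n, IsDaubechiesFilter (n + 1) (h (n + 1))) {ω : ℝ} (h1 : |ω| ≠ Real.pi)
    (h2 : |ω| ≠ 2 * Real.pi) :
    Tendsto (fun n => ‖waveletHat (n + 1) (h (n + 1)) ω‖) atTop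
      (𝓝 (band.indicator (fun _ => 1 / Real.sqrt (2 * Real.pi)) ω)) := by
  have hpi := Real.pi_pos
  have h4 : |ω / 2 / 2| = |ω| / 4 := by rw [div_div, abs_div]; norm_num
  have h5 : |ω / 2| = |ω| / 2 := by rw [abs_div, abs_two]
  have hnn : ∀ n, 0 ≤ ‖trigPoly (n + 1) (h (n + 1)) (ω / 2 + Real.pi)‖ *
      ‖scalingProd (n + 1) (h (n + 1)) (ω / 2)‖ := fun n => by positivity
  have hH0 : ∀ n, 0 ≤ ‖trigPoly (n + 1) (h (n + 1)) (ω / 2 + Real.pi)‖ ^ 2 := fun n => sq_nonneg _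
  have hS0 : ∀ n, 0 ≤ ‖scalingProd (n + 1) (h (n + 1)) (ω / 2)‖ ^ 2 := fun n => sq_nonneg _
  have hH1 : ∀ n, ‖trigPoly (n + 1) (h (n + 1)) (ω / 2 + Real.pi)‖ ^ 2 ≤ 1 := fun n =>
    pow_le_one₀ (norm_nonneg _) ((hh n).norm_le_one _)
  have hS1 : ∀ n, ‖scalingProd (n + 1) (h (n + 1)) (ω / 2)‖ ^ 2 ≤ 1 := fun n =>
    pow_le_one₀ (norm_nonneg _) ((hh n).norm_scalingProd_le_one _)
  have hsq : Tendsto (fun n => (‖trigPoly (n + 1) (h (n + 1)) (ω / 2 + Real.pi)‖ *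
      ‖scalingProd (n + 1) (h (n + 1)) (ω / 2)‖) ^ 2) atTop
        (𝓝 (band.indicator (fun _ => (1 : ℝ)) ω)) := by
    simp_rw [mul_pow]
    rcases lt_or_gt_of_ne h1 with hlt | hgt
    · rw [Set.indicator_of_notMem fun hω => absurd hω.1 hlt.not_gt]
      have hs : Real.sin (ω / 2 / 2) ^ 2 < 1 / 2 := sin_sq_lt_half (by rw [h4]; linarith)
      have ht := tendsto_filterSq_of_half_lt (x := 1 - Real.sin (ω / 2 / 2) ^ 2) (by linarith)
        (by linarith [sq_nonneg (Real.sin (ω / 2 / 2))])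
      refine squeeze_zero (fun n => mul_nonneg (hH0 n) (hS0 n)) (fun n => ?_) ht
      rw [← (hh n).norm_add_pi_sq]
      exact mul_le_of_le_one_right (hH0 n) (hS1 n)
    rcases lt_or_gt_of_ne h2 with hlt2 | hgt2
    · rw [Set.indicator_of_mem (show ω ∈ band from ⟨hgt, hlt2⟩)]
      have hs : 1 / 2 < Real.sin (ω / 2 / 2) ^ 2 :=
        half_lt_sin_sq (by rw [h4]; linarith) (by rw [h4]; linarith)
      have ht := tendsto_filterSq_of_lt_half (x := 1 - Real.sin (ω / 2 / 2) ^ 2)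
        (by linarith [Real.sin_sq_le_one (ω / 2 / 2)]) (by linarith)
      have ht2 := tendsto_norm_scalingProd_of_lt hh (ω := ω / 2) (by rw [h5]; linarith)
      have ht3 := ht.mul ht2
      rw [mul_one] at ht3
      refine ht3.congr fun n => ?_
      rw [← (hh n).norm_add_pi_sq]
    · rw [Set.indicator_of_notMem fun hω => absurd hω.2 hgt2.not_gt]
      have ht := tendsto_norm_scalingProd_of_gt hh (ω := ω / 2) (by rw [h5]; linarith)
      refine squeeze_zero (fun n => mul_nonneg (hH0 n) (hS0 n)) (fun n => ?_) ht
      exact mul_le_of_le_one_left (hS0 n) (hH1 n)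
  have hsqrt := (hsq.sqrt).const_mul (1 / Real.sqrt (2 * Real.pi))
  have e : 1 / Real.sqrt (2 * Real.pi) * Real.sqrt (band.indicator (fun _ => (1 : ℝ)) ω) =
      band.indicator (fun _ => 1 / Real.sqrt (2 * Real.pi)) ω := by
    by_cases hω : ω ∈ band <;> simp [hω]
  rw [e] at hsqrt
  refine hsqrt.congr fun n => ?_
  rw [Real.sqrt_sq (hnn n), norm_waveletHat]

/-! ### Limits of the norms and their values -/

/-- The modulus of the limit of `primitiveHat k ψ_m`. -/
noncomputable def limitModulus (k : ℕ) (ω : ℝ) : ℝ :=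
  (|ω| ^ k)⁻¹ * band.indicator (fun _ => 1 / Real.sqrt (2 * Real.pi)) ω

lemma limitModulus_nonneg (k : ℕ) (ω : ℝ) : 0 ≤ limitModulus k ω :=
  mul_nonneg (by positivity) (Set.indicator_nonneg (fun _ _ => by positivity) _)

lemma tendsto_eLpNorm_primitiveHat (k : ℕ) {r : ℝ} (hr : 1 < r) {ψ : ℕ → L2}
    (hψ : ∀ m : ℕ, 1 ≤ m → IsDaubechiesWavelet m (ψ m)) :
    Tendsto (fun m => eLpNorm (primitiveHat k (ψ m)) (ENNReal.ofReal r) volume) atTop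
      (𝓝 ((∫⁻ ω, ENNReal.ofReal (limitModulus k ω ^ r)) ^ (1 / r))) := by
  have hr0 : 0 < r := by linarith
  choose! h hh hae using hψ
  have hh' : ∀ n, IsDaubechiesFilter (n + 1) (h (n + 1)) := fun n => hh _ (by lia)
  rw [← tendsto_add_atTop_iff_nat 1]
  simp_rw [eLpNorm_eq_lintegral_rpow_enorm_toReal (by simpa using hr0 : ENNReal.ofReal r ≠ 0)
    ENNReal.ofReal_ne_top, ENNReal.toReal_ofReal hr0.le]
  refine (ENNReal.continuous_rpow_const.tendsto _).comp ?_
  have hall : ∀ᵐ ω, ∀ n : ℕ, hat (ψ (n + 1)) ω = waveletHat (n + 1) (h (n + 1)) ω :=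
    ae_all_iff.2 fun n => hae (n + 1) (by lia)
  have hnorm : ∀ n ω, ‖primitiveHat k (ψ (n + 1)) ω‖ₑ ^ r =
      ENNReal.ofReal (((|ω| ^ k)⁻¹ * ‖hat (ψ (n + 1)) ω‖) ^ r) := fun n ω => by
    rw [primitiveHat, ← ofReal_norm, norm_mul, norm_inv, norm_I_mul_pow,
      ENNReal.ofReal_rpow_of_nonneg (by positivity) hr0.le]
  simp_rw [hnorm]
  refine tendsto_lintegral_filter_of_dominated_convergence
    (fun ω => ENNReal.ofReal ((2 ^ 40 * (1 + ω ^ 2)⁻¹) ^ r)) (Eventually.of_forall fun n => ?_)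
    ?_ ?_ ?_
  · exact (((measurable_id.abs.pow_const k).inv.mul (measurable_hat _).norm).pow_const r).ennreal_ofReal
  · filter_upwards [eventually_ge_atTop 20, eventually_ge_atTop k] with n hn hk
    have h0 : ∀ᵐ ω : ℝ, ω ≠ 0 := by simp [ae_iff]
    filter_upwards [hall, h0] with ω hω hω0
    have : 0 < |ω| := abs_pos.2 hω0
    refine ENNReal.ofReal_le_ofReal (Real.rpow_le_rpow (by positivity) ?_ hr0.le)
    rw [hω n, inv_mul_le_iff₀ (by positivity)]
    exact (hh' n).norm_waveletHat_le hn hk ω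
  · have hint : Integrable fun ω : ℝ => (2 ^ 40 : ℝ) ^ r * (1 + ω ^ 2)⁻¹ :=
      integrable_inv_one_add_sq.const_mul _
    refine (lt_of_le_of_lt (lintegral_mono fun ω => ENNReal.ofReal_le_ofReal ?_)
      ((hasFiniteIntegral_iff_ofReal (Eventually.of_forall fun ω => by positivity)).1 hint.2)).ne
    rw [Real.mul_rpow (by positivity) (by positivity)]
    gcongr
    refine Real.rpow_le_self_of_le_one (by positivity) ?_ hr.le
    exact inv_le_one_of_one_le₀ (by nlinarith [sq_nonneg ω])
  · have hae1 : ∀ a : ℝ, ∀ᵐ ω : ℝ, |ω| ≠ a := fun a => by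
      have h1 : ∀ᵐ ω : ℝ, ω ≠ a := by simp [ae_iff]
      have h2 : ∀ᵐ ω : ℝ, ω ≠ -a := by simp [ae_iff]
      filter_upwards [h1, h2] with ω hω1 hω2 hω
      rcases abs_choice ω with h | h <;> rw [h] at hω
      · exact hω1 hω
      · exact hω2 (by linarith)
    filter_upwards [hall, hae1 Real.pi, hae1 (2 * Real.pi)] with ω hω h1 h2
    simp_rw [hω]
    refine ENNReal.tendsto_ofReal (Tendsto.rpow_const ?_ (Or.inr hr0.le))
    exact (tendsto_norm_waveletHat hh' h1 h2).const_mul _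

lemma lintegral_limitModulus (k : ℕ) {r : ℝ} (hr : 1 < r) :
    0 < (1 - (2 : ℝ) ^ (1 - r * k)) / (r * k - 1) ∧
    ∫⁻ ω, ENNReal.ofReal (limitModulus k ω ^ r) = ENNReal.ofReal
      ((1 / Real.sqrt (2 * Real.pi)) ^ r * (2 * Real.pi) * (Real.pi ^ k)⁻¹ ^ r *
        ((1 - (2 : ℝ) ^ (1 - r * k)) / (r * k - 1))) := by
  have hpi := Real.pi_pos
  have hr0 : 0 < r := by linarith
  set s := r * k with hs
  set c := 1 / Real.sqrt (2 * Real.pi) with hc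
  have hc0 : 0 < c := by positivity
  -- The logarithmic case s = 1 never occurs: s = 0 if k = 0, and s ≥ r > 1 otherwise.
  have hs1 : s < 1 ∨ 1 < s := by
    rcases Nat.eq_zero_or_pos k with rfl | hk
    · left; simp [hs]
    · right
      have : (1 : ℝ) ≤ k := by exact_mod_cast hk
      nlinarith
  have hQ : 0 < (1 - (2 : ℝ) ^ (1 - s)) / (s - 1) := by
    rcases hs1 with h | h
    · have := Real.one_lt_rpow (one_lt_two : (1 : ℝ) < 2) (show 0 < 1 - s by linarith)
      exact div_pos_of_neg_of_neg (by linarith) (by linarith)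
    · have := Real.rpow_lt_one_of_one_lt_of_neg (one_lt_two : (1 : ℝ) < 2)
        (show 1 - s < 0 by linarith)
      exact div_pos (by linarith) (by linarith)
  refine ⟨hQ, ?_⟩
  set V := c ^ r * (2 * Real.pi) * (Real.pi ^ k)⁻¹ ^ r * ((1 - (2 : ℝ) ^ (1 - s)) / (s - 1)) with hV
  have hV0 : 0 < V := by positivity
  have hpow : ∀ x : ℝ, 0 < x → (x ^ k)⁻¹ ^ r = x ^ (-s) := fun x hx => by
    rw [← Real.rpow_natCast, ← Real.rpow_neg hx.le, ← Real.rpow_mul hx.le, hs]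
    congr 1
    ring
  have habs : ∀ ω, limitModulus k ω ^ r =
      (fun x => (Set.Ioo Real.pi (2 * Real.pi)).indicator (fun x => c ^ r * x ^ (-s)) x) |ω| :=
    fun ω => by
    by_cases hω : ω ∈ band
    · have hω0 : 0 < |ω| := hpi.trans hω.1
      simp only
      rw [limitModulus, Set.indicator_of_mem hω, Set.indicator_of_mem (show |ω| ∈ Set.Ioo _ _ from hω),
        Real.mul_rpow (by positivity) hc0.le, hpow _ hω0, mul_comm]
    · simp only
      rw [limitModulus, Set.indicator_of_notMem hω,
        Set.indicator_of_notMem (show |ω| ∉ Set.Ioo _ _ from hω), mul_zero, Real.zero_rpow hr0.ne']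
  have hint : ∫ ω, limitModulus k ω ^ r = V := by
    simp_rw [habs]
    rw [integral_comp_abs, setIntegral_indicator measurableSet_Ioo,
      Set.inter_eq_right.2 (show Set.Ioo Real.pi (2 * Real.pi) ⊆ Set.Ioi 0 from
        fun x hx => hpi.trans hx.1), integral_const_mul,
      ← integral_Ioc_eq_integral_Ioo, ← intervalIntegral.integral_of_le (by linarith),
      integral_rpow (Or.inr ⟨?_, ?_⟩), hV, hpow _ hpi]
    · rw [Real.mul_rpow two_pos.le hpi.le, show -s + 1 = 1 + -s by ring, Real.rpow_add hpi,
        Real.rpow_one, ← sub_eq_add_neg]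
      have h1 : 1 - s ≠ 0 := by rcases hs1 with h | h <;> intro <;> linarith
      have h2 : s - 1 ≠ 0 := by rcases hs1 with h | h <;> intro <;> linarith
      field_simp
      ring
    · rcases hs1 with h | h <;> intro <;> linarith
    · rw [Set.uIcc_of_le (by linarith)]
      exact fun h => absurd h.1 (by linarith)
  rw [← ofReal_integral_eq_lintegral_ofReal
    -- A nonintegrable function has Bochner integral 0 by default, so the positive value already
    -- proves integrability.
    (Integrable.of_integral_ne_zero (by rw [hint]; exact hV0.ne'))
    (Eventually.of_forall fun ω => Real.rpow_nonneg (limitModulus_nonneg k ω) r), hint]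

lemma lintegral_limitModulus_rpow (k : ℕ) {r : ℝ} (hr : 1 < r) :
    (∫⁻ ω, ENNReal.ofReal (limitModulus k ω ^ r)) ^ (1 / r) = ENNReal.ofReal
      (1 / Real.sqrt (2 * Real.pi) * (2 * Real.pi) ^ (1 / r) * (Real.pi ^ k)⁻¹ *
        ((1 - (2 : ℝ) ^ (1 - r * k)) / (r * k - 1)) ^ (1 / r)) := by
  obtain ⟨hQ, hI⟩ := lintegral_limitModulus k hr
  have hpi := Real.pi_pos
  have hr0 : 0 < r := by linarith
  have hcancel : ∀ x : ℝ, 0 ≤ x → (x ^ r) ^ (1 / r) = x := fun x hx => by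
    rw [← Real.rpow_mul hx, mul_one_div_cancel hr0.ne', Real.rpow_one]
  rw [hI, ENNReal.ofReal_rpow_of_pos (by positivity), Real.mul_rpow (by positivity) hQ.le,
    Real.mul_rpow (by positivity) (by positivity), Real.mul_rpow (by positivity) (by positivity),
    hcancel _ (by positivity), hcancel _ (by positivity)]

lemma primitiveHat_zero (ψ : L2) : primitiveHat 0 ψ = hat ψ := by
  funext ω
  simp [primitiveHat]

end Wavelet

theorem theorem1 (k : ℕ) (p q : ℝ) (hp : 1 < p) (hq : 1 < q)
    (ψ : ℕ → Wavelet.L2) (hψ : ∀ m : ℕ, 1 ≤ m → Wavelet.IsDaubechiesWavelet m (ψ m)) :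
    (∀ m : ℕ, 1 ≤ m → k ≤ m →
      Wavelet.sharpConst k p q (ψ m) =
        eLpNorm (Wavelet.primitiveHat k (ψ m)) (ENNReal.ofReal p) volume /
          eLpNorm (Wavelet.hat (ψ m)) (ENNReal.ofReal q) volume) ∧
    Tendsto (fun m : ℕ => Wavelet.sharpConst k p q (ψ m)) atTop
      (𝓝 (ENNReal.ofReal ((2 * Real.pi) ^ (1 / p - 1 / q) / Real.pi ^ k *
        ((1 - (2 : ℝ) ^ (1 - p * k)) / (p * k - 1)) ^ (1 / p)))) := by
  refine ⟨fun m _ _ => Wavelet.sharpConst_eq k q hp (ψ m), ?_⟩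
  have hpi := Real.pi_pos
  have hnum := Wavelet.tendsto_eLpNorm_primitiveHat k hp hψ
  have hden := Wavelet.tendsto_eLpNorm_primitiveHat 0 hq hψ
  rw [Wavelet.lintegral_limitModulus_rpow k hp] at hnum
  rw [Wavelet.lintegral_limitModulus_rpow 0 hq] at hden
  simp only [Wavelet.primitiveHat_zero] at hden
  -- For exponent 0 the quotient is (1-2)/(0-1) = 1, leaving only the band's measure and height in
  -- the denominator.
  have hone : ((1 - (2 : ℝ) ^ (1 - q * (0 : ℕ))) / (q * (0 : ℕ) - 1)) ^ (1 / q) = 1 := by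
    norm_num
  rw [hone, pow_zero, inv_one, mul_one, mul_one] at hden
  have hden0 : 0 < 1 / Real.sqrt (2 * Real.pi) * (2 * Real.pi) ^ (1 / q) := by positivity
  have hlim := ENNReal.Tendsto.div hnum (Or.inr (ENNReal.ofReal_pos.2 hden0).ne') hden
    (Or.inl ENNReal.ofReal_ne_top)
  simp_rw [Wavelet.sharpConst_eq k q hp]
  rw [← ENNReal.ofReal_div_of_pos hden0] at hlim
  convert hlim using 3
  rw [Real.rpow_sub (by positivity)]
  field_simp
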